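/- Let $q$ be a prime power, let $\mathbb{F}_q$ be the field with $q$ elements, and let $k$ be an integer with $k\ge 5$ and $q\ge k-2$. An $[n,k,d]_q$ code is an $\mathbb{F}_q$-linear subspace of $\mathbb{F}_q^n$ of dimension $k$ whose minimum Hamming distance equals $d$. Put $g_q(k,d)=\sum_{i=0}^{k-1}\lceil d/q^i\rceil$; the Griesmer bound states that every $[n,k,d]_q$ code satisfies $n\ge g_q(k,d)$. Then for every integer $d$ with $$(k-3)q^{k-1}-3q^{k-2}+q^{k-3}-q^2+q\ \le\ d\ \le\ (k-3)q^{k-1}-3q^{k-2}+q^{k-3}$$ there exists a $[g_q(k,d),k,d]_q$ code, that is, a code of dimension $k$ and minimum distance $d$ that attains the Griesmer bound. -/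

import Mathlib

/-- The Griesmer bound: the sum of `⌈d / q ^ i⌉` over `0 ≤ i ≤ k - 1`. -/
def griesmerBound (q k d : ℕ) : ℕ :=
  ∑ i ∈ Finset.range k, ⌈(d : ℚ) / (q : ℚ) ^ i⌉₊

/-- `IsLinearCode n k d C`: the linear subspace `C` of `F ^ n` is an `[n, k, d]` code over `F`,
that is, it has dimension `k` and its minimum Hamming distance is exactly `d`. -/
def IsLinearCode {F : Type*} [Field F] [DecidableEq F] (n k d : ℕ)
    (C : Submodule F (Fin n → F)) : Prop :=
  Module.finrank F C = k ∧
    IsLeast {w : ℕ | ∃ x ∈ C, ∃ y ∈ C, x ≠ y ∧ hammingDist x y = w} d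

/-!
Write `k = m + 3`, so `m ≥ 2`, and `d = d₀ - e` with
`d₀ = m q ^ (m + 2) - 3 q ^ (m + 1) + q ^ m` and `0 ≤ e ≤ q ^ 2 - q`. A code of dimension `k` is the
same as a multiset of points of a projective space of dimension `k - 1`, read as the columns of a
generator matrix; its minimum weight is the least number of points missed by a hyperplane.

In the space of triples `(p, g, s)`, with `p` a polynomial of degree at most `m` and `g`, `s`
scalars, take every point `m` times and remove the hyperplane where the coefficient of `X ^ m`
in `p` vanishes, the hyperplane `s = 0`, and for each `a` in the field the space of codimension two
`g + a s = 0`, `p(a) = 0`; then add back the axis `g = s = 0`. Multiplicities are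
nonnegative because a nonzero `p` has at most `m` roots on the projective line
(`ColumnSpace.defect_le`). A hyperplane misses `q ^ r` points of an `r`-dimensional projective
subspace it does not contain, and none of one it contains. So the only hyperplanes that could be
short of `d₀` missed points are those containing the axis; but these form the pencil `s = 0`,
`g + a s = 0`, and each of them contains another removed space, which compensates the loss
(`ColumnSpace.le_sum_sub_defect_of_ne_zero`). This settles `e = 0`.

For `e > 0` one further deletes `⌊e / q⌋` disjoint lines and `e % q` points of one more line
(`exists_points_on_lines`), using the lines of vectors `(c (u X ^ m + w), u, w)` for `c ≠ 0`, all of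
whose points have multiplicity at least `m - 1`
(`ColumnSpace.defect_le_one_of_mem_line`). Every hyperplane meets a line, so at most `e` missed points
are lost, while the length decreases by `e + ⌊e / q⌋`, as the Griesmer sum does
(`griesmerBound_eq`). That the minimum distance is `d` and not larger is arranged by replacing
superfluous columns by zero (`exists_isLinearCode_of_columns`).
-/

/-! ### Codes from families of columns -/

/-- A family of vectors `v i` of a `k`-dimensional space such that every nonzero functional is
nonzero on at least `d` of them yields a code of minimum distance exactly `d`: columns outside
a minimal set with this property are replaced by zero. -/
theorem exists_isLinearCode_of_columns {F V : Type*} [Field F] [DecidableEq F]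
    [AddCommGroup V] [Module F V] [FiniteDimensional F V] [Nontrivial V] {n k d : ℕ}
    (hk : Module.finrank F V = k) (hd : 0 < d) (v : Fin n → V)
    (hv : ∀ h : Module.Dual F V, h ≠ 0 → d ≤ Finset.card {i | h (v i) ≠ 0}) :
    ∃ C : Submodule F (Fin n → F), IsLinearCode n k d C := by
  obtain ⟨S, hS⟩ := exists_minimal_of_wellFoundedLT
    (fun S : Finset (Fin n) ↦ ∀ h : Module.Dual F V, h ≠ 0 →
      d ≤ Finset.card {i ∈ S | h (v i) ≠ 0}) ⟨Finset.univ, by simpa using hv⟩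
  obtain ⟨h₀, hh₀⟩ := exists_ne (0 : Module.Dual F V)
  -- Some functional attains `d` on `S`; otherwise any element of `S` could be dropped.
  obtain ⟨h₁, hh₁, hd₁⟩ : ∃ h : Module.Dual F V, h ≠ 0 ∧
      Finset.card {i ∈ S | h (v i) ≠ 0} = d := by
    by_contra! hcon
    have hne : S.Nonempty := by
      have h1 := hS.prop h₀ hh₀
      obtain ⟨i, hi⟩ := Finset.card_pos.mp (hd.trans_le h1)
      exact ⟨i, (Finset.mem_filter.mp hi).1⟩
    obtain ⟨i, hi⟩ := hne
    have hlt : ∀ h : Module.Dual F V, h ≠ 0 →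
        d ≤ Finset.card {j ∈ S.erase i | h (v j) ≠ 0} := by
      intro h hh
      have h1 := lt_of_le_of_ne (hS.prop h hh) (hcon h hh).symm
      rw [Finset.filter_erase]
      have h2 := Finset.pred_card_le_card_erase (s := {j ∈ S | h (v j) ≠ 0}) (a := i)
      lia
    exact Finset.notMem_erase i S (hS.le_of_le hlt (Finset.erase_subset i S) hi)
  let w : Fin n → V := fun i ↦ if i ∈ S then v i else 0
  let φ : Module.Dual F V →ₗ[F] (Fin n → F) :=
    { toFun := fun h i ↦ h (w i)
      map_add' := fun _ _ ↦ rfl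
      map_smul' := fun _ _ ↦ rfl }
  have hdist : ∀ h h' : Module.Dual F V,
      hammingDist (φ h) (φ h') = Finset.card {i ∈ S | (h - h') (v i) ≠ 0} := by
    intro h h'
    unfold hammingDist
    congr 1
    ext i
    by_cases hi : i ∈ S <;> simp [φ, w, hi, sub_eq_zero]
  have hinj : Function.Injective φ := by
    intro h h' heq
    by_contra hne
    have h1 := hS.prop (h - h') (sub_ne_zero.mpr hne)
    rw [← hdist, heq, hammingDist_self] at h1
    lia
  refine ⟨LinearMap.range φ, ?_, ?_, ?_⟩
  · rw [LinearMap.finrank_range_of_inj hinj, Subspace.dual_finrank_eq, hk]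
  · refine ⟨φ h₁, ⟨h₁, rfl⟩, φ 0, ⟨0, rfl⟩, fun h ↦ hh₁ (hinj h), ?_⟩
    rw [hdist, sub_zero, hd₁]
  · rintro _ ⟨_, ⟨h, rfl⟩, _, ⟨h', rfl⟩, hne, rfl⟩
    rw [hdist]
    exact hS.prop _ (sub_ne_zero.mpr fun heq ↦ hne (by rw [heq]))

/-! ### Counting points of projective subspaces -/

section Points

open scoped LinearAlgebra.Projectivization Classical

variable {F V : Type*} [Field F] [AddCommGroup V] [Module F V] [Fintype (ℙ F V)]

/-- A multiset of points of a projective space, given by its multiplicity function `M`, yields a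
code of length the size of the multiset: a column is taken for each point, with multiplicity. -/
theorem exists_isLinearCode_of_multiplicity [FiniteDimensional F V] [Nontrivial V] {n k d : ℕ}
    (hk : Module.finrank F V = k) (hd : 0 < d) (M : ℙ F V → ℕ) (hn : ∑ x, M x = n)
    (hM : ∀ h : Module.Dual F V, h ≠ 0 → d ≤ ∑ x with h x.rep ≠ 0, M x) :
    ∃ C : Submodule F (Fin n → F), IsLinearCode n k d C := by
  have hcard : Fintype.card (Σ x, Fin (M x)) = n := by simp [hn]
  let e : Fin n ≃ Σ x, Fin (M x) := (Fintype.equivFinOfCardEq hcard).symm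
  refine exists_isLinearCode_of_columns hk hd (fun i ↦ (e i).1.rep) fun h hh ↦ ?_
  refine (hM h hh).trans (le_of_eq ?_)
  have h1 : Finset.card {i | h (e i).1.rep ≠ 0} =
      Finset.card {y : Σ x, Fin (M x) | h y.1.rep ≠ 0} :=
    Finset.card_equiv e (by simp)
  have h2 : ({y : Σ x, Fin (M x) | h y.1.rep ≠ 0} : Finset _) =
      Finset.sigma {x | h x.rep ≠ 0} fun _ ↦ Finset.univ := by
    ext y; simp
  rw [h1, h2]
  simp

/-- The finite set of points of the projective subspace given by a linear subspace `U`. -/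
noncomputable def projPoints (U : Submodule F V) : Finset (ℙ F V) := {x | x.rep ∈ U}

@[simp]
theorem mem_projPoints {U : Submodule F V} {x : ℙ F V} : x ∈ projPoints U ↔ x.rep ∈ U := by
  simp [projPoints]

theorem card_projPoints_filter_ne_eq_zero (U : Submodule F V) (h : Module.Dual F V)
    (hU : ∀ u ∈ U, h u = 0) : Finset.card {x ∈ projPoints U | h x.rep ≠ 0} = 0 := by
  simpa [Finset.filter_eq_empty_iff] using fun x hx ↦ hU _ hx

variable [Fintype F]

theorem card_projPoints (U : Submodule F V) {r : ℕ} (hr : Module.finrank F U = r) :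
    (projPoints U).card = ∑ i ∈ Finset.range r, Fintype.card F ^ i := by
  have hinj := Projectivization.map_injective U.subtype U.subtype_injective
  have : Finite (ℙ F U) := Finite.of_injective _ hinj
  have : Fintype (ℙ F U) := Fintype.ofFinite _
  have h1 : projPoints U =
      Finset.univ.image (Projectivization.map U.subtype U.subtype_injective) := by
    ext x
    simp only [mem_projPoints, Finset.mem_image, Finset.mem_univ, true_and]
    constructor
    · intro hx
      refine ⟨Projectivization.mk F ⟨x.rep, hx⟩ fun h ↦ x.rep_nonzero (congrArg Subtype.val h), ?_⟩
      rw [Projectivization.map_mk]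
      exact x.mk_rep
    · rintro ⟨y, rfl⟩
      induction y with | h u hu => ?_
      rw [Projectivization.map_mk]
      obtain ⟨a, ha⟩ := Projectivization.exists_smul_eq_mk_rep F (U.subtype u)
        fun h ↦ hu (Subtype.ext h)
      rw [← ha]
      exact U.smul_mem _ u.2
  rw [h1, Finset.card_image_of_injective _ hinj, Finset.card_univ, ← Nat.card_eq_fintype_card,
    Projectivization.card_of_finrank F U hr, Nat.card_eq_fintype_card]

theorem finrank_inf_ker_add_one {F V : Type*} [Field F] [AddCommGroup V] [Module F V]
    [FiniteDimensional F V] (U : Submodule F V) (h : Module.Dual F V) {u : V} (hu : u ∈ U)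
    (hhu : h u ≠ 0) :
    Module.finrank F (U ⊓ LinearMap.ker h : Submodule F V) + 1 = Module.finrank F U := by
  have h1 : h ∘ₗ U.subtype ≠ 0 := fun h0 ↦ hhu (LinearMap.congr_fun h0 ⟨u, hu⟩)
  have h2 := Module.Dual.finrank_ker_add_one_of_ne_zero (f := h ∘ₗ U.subtype) h1
  rw [← h2, LinearMap.ker_comp]
  rw [← Submodule.map_comap_subtype, Submodule.finrank_map_subtype_eq]

/-- A hyperplane not containing an `r`-dimensional projective subspace misses `q ^ r` of its
points. -/
theorem card_projPoints_filter_ne [FiniteDimensional F V] (U : Submodule F V)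
    (h : Module.Dual F V) {r : ℕ} (hr : Module.finrank F U = r + 1) {u : V} (hu : u ∈ U)
    (hhu : h u ≠ 0) :
    Finset.card {x ∈ projPoints U | h x.rep ≠ 0} = Fintype.card F ^ r := by
  have h1 := finrank_inf_ker_add_one U h hu hhu
  have h2 := card_projPoints (U ⊓ LinearMap.ker h) (r := r) (by lia)
  have h3 := card_projPoints U hr
  have h4 := Finset.card_filter_add_card_filter_not (s := projPoints U) (fun x ↦ h x.rep = 0)
  have h5 : projPoints (U ⊓ LinearMap.ker h) = {x ∈ projPoints U | h x.rep = 0} := by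
    ext x; simp
  rw [h3, ← h5, h2, Finset.sum_range_succ] at h4
  simpa using h4

theorem card_projPoints_filter_ne_le [FiniteDimensional F V] (U : Submodule F V)
    (h : Module.Dual F V) {r : ℕ} (hr : Module.finrank F U = r + 1) :
    Finset.card {x ∈ projPoints U | h x.rep ≠ 0} ≤ Fintype.card F ^ r := by
  by_cases hU : ∀ u ∈ U, h u = 0
  · simp [card_projPoints_filter_ne_eq_zero U h hU]
  · push Not at hU
    obtain ⟨u, hu, hhu⟩ := hU
    exact (card_projPoints_filter_ne U h hr hu hhu).le

/-- Out of `q - 1` pairwise disjoint lines one can choose a set of `e + ⌊e / q⌋` points that meets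
the complement of every hyperplane in at most `e` points: `⌊e / q⌋` full lines and `e % q` points
of another one. -/
theorem exists_points_on_lines [FiniteDimensional F V] (W : Fˣ → Submodule F V)
    (hW : ∀ c, Module.finrank F (W c) = 2) (hdisj : Pairwise fun c c' ↦ Disjoint (W c) (W c'))
    {e : ℕ} (he : e + Fintype.card F ≤ Fintype.card F ^ 2) :
    ∃ R : Finset (ℙ F V), R.card = e + e / Fintype.card F ∧ (∀ x ∈ R, ∃ c, x.rep ∈ W c) ∧
      ∀ h : Module.Dual F V, Finset.card {x ∈ R | h x.rep ≠ 0} ≤ e := by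
  set q := Fintype.card F with hq
  have hq0 : 0 < q := Fintype.card_pos
  have hdisj' : ∀ c c', c ≠ c' → Disjoint (projPoints (W c)) (projPoints (W c')) := by
    intro c c' hc
    rw [Finset.disjoint_left]
    intro x hx hx'
    exact x.rep_nonzero (Submodule.disjoint_def.mp (hdisj hc) _
      (mem_projPoints.mp hx) (mem_projPoints.mp hx'))
  have hcardW : ∀ c, (projPoints (W c)).card = q + 1 := by
    intro c
    rw [card_projPoints _ (hW c), geom_sum_two]
  have hunits : Fintype.card Fˣ + 1 = q := by
    rw [Fintype.card_units, ← hq]; lia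
  have hediv := Nat.div_add_mod e q
  have hmod := Nat.mod_lt e hq0
  have hdiv : e / q < q := Nat.div_lt_of_lt_mul (by nlinarith)
  obtain ⟨T, -, hT⟩ := Finset.exists_subset_card_eq (s := (Finset.univ : Finset Fˣ)) (n := e / q)
    (by rw [Finset.card_univ]; lia)
  obtain ⟨B, hB, hBW, hBT⟩ : ∃ B : Finset (ℙ F V), B.card = e % q ∧
      (∀ x ∈ B, ∃ c, x.rep ∈ W c) ∧ Disjoint (T.biUnion fun c ↦ projPoints (W c)) B := by
    rcases Nat.eq_zero_or_pos (e % q) with hb | hb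
    · exact ⟨∅, by simp [hb], by simp, by simp⟩
    · have hT' : T.card < Fintype.card Fˣ := by
        have : q * (e / q + 1) < q * q := by nlinarith
        have := Nat.lt_of_mul_lt_mul_left this
        lia
      obtain ⟨c, -, hc⟩ := Finset.exists_mem_notMem_of_card_lt_card
        (s := T) (t := Finset.univ) (by simpa using hT')
      obtain ⟨B, hBs, hB⟩ := Finset.exists_subset_card_eq (s := projPoints (W c)) (n := e % q)
        (by rw [hcardW]; lia)
      refine ⟨B, hB, fun x hx ↦ ⟨c, mem_projPoints.mp (hBs hx)⟩, ?_⟩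
      rw [Finset.disjoint_biUnion_left]
      exact fun c' hc' ↦ (hdisj' c' c fun h ↦ hc (h ▸ hc')).mono_right hBs
  refine ⟨(T.biUnion fun c ↦ projPoints (W c)) ∪ B, ?_, ?_, ?_⟩
  · rw [Finset.card_union_of_disjoint hBT, Finset.card_biUnion fun c _ c' _ h ↦ hdisj' c c' h, hB]
    simp only [hcardW, Finset.sum_const, hT, smul_eq_mul]
    nlinarith
  · intro x hx
    rcases Finset.mem_union.mp hx with hx | hx
    · obtain ⟨c, -, hc⟩ := Finset.mem_biUnion.mp hx
      exact ⟨c, mem_projPoints.mp hc⟩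
    · exact hBW x hx
  · intro h
    rw [Finset.filter_union, Finset.filter_biUnion]
    refine (Finset.card_union_le _ _).trans ?_
    have h1 : Finset.card (T.biUnion fun c ↦ {x ∈ projPoints (W c) | h x.rep ≠ 0}) ≤
        e / q * q := by
      refine (Finset.card_biUnion_le_card_mul _ _ q fun c _ ↦ ?_).trans (by rw [hT])
      simpa using card_projPoints_filter_ne_le (W c) h (hW c)
    have h2 := Finset.card_filter_le B fun x ↦ h x.rep ≠ 0
    nlinarith

end Points

/-! ### The Griesmer sum -/

theorem natCast_ceil_div_pow {q d i : ℕ} (hq : 0 < q) {z : ℤ} (h₁ : (z - 1) * (q : ℤ) ^ i < d)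
    (h₂ : (d : ℤ) ≤ z * (q : ℤ) ^ i) : ((⌈(d : ℚ) / (q : ℚ) ^ i⌉₊ : ℕ) : ℤ) = z := by
  have hqi : (0 : ℚ) < (q : ℚ) ^ i := by positivity
  rw [Int.natCast_ceil_eq_ceil (by positivity), Int.ceil_eq_iff, lt_div_iff₀ hqi, div_le_iff₀ hqi]
  exact ⟨by exact_mod_cast h₁, by exact_mod_cast h₂⟩

/-- The Griesmer bound at `d = m q ^ (m + 2) - 3 q ^ (m + 1) + q ^ m - e`. The last two summands
are `m q - 2` and `m`; the `i`-th of the others is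
`(m q ^ 2 - 3 q + 1) q ^ (m - i) - ⌊e / q ^ i⌋`. -/
theorem griesmerBound_eq {q m d e : ℕ} (hq : 3 ≤ q) (hm : 2 ≤ m) (he : e + q ≤ q ^ 2)
    (hd : (d : ℤ) = m * (q : ℤ) ^ (m + 2) - 3 * (q : ℤ) ^ (m + 1) + (q : ℤ) ^ m - e) :
    (griesmerBound q (m + 3) d : ℤ) =
      m * ∑ i ∈ Finset.range (m + 3), (q : ℤ) ^ i - 2 * ∑ i ∈ Finset.range (m + 2), (q : ℤ) ^ i
        - (q - 1) * ∑ i ∈ Finset.range (m + 1), (q : ℤ) ^ i - e - (e / q : ℕ) := by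
  have hq0 : 0 < q := by lia
  have heq : e < q ^ 2 := by lia
  have heqm : e < q ^ m := heq.trans_le (Nat.pow_le_pow_right hq0 hm)
  have heqm' : (e : ℤ) < (q : ℤ) ^ m := by exact_mod_cast heqm
  have hq3 : (3 : ℤ) ≤ q := by exact_mod_cast hq
  have hqm : (0 : ℤ) < (q : ℤ) ^ m := by positivity
  have he0 : (0 : ℤ) ≤ e := by positivity
  have hqqm : 3 * ((q : ℤ) ^ m * q) ≤ (q : ℤ) ^ m * q * q := by
    rw [mul_comm]; gcongr
  unfold griesmerBound
  rw [Finset.sum_range_succ, Finset.sum_range_succ, Nat.cast_add, Nat.cast_add, Nat.cast_sum]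
  have hlow : ∀ i ∈ Finset.range (m + 1), ((⌈(d : ℚ) / (q : ℚ) ^ i⌉₊ : ℕ) : ℤ) =
      (m * (q : ℤ) ^ 2 - 3 * q + 1) * (q : ℤ) ^ (m - i) - (e / q ^ i : ℕ) := by
    intro i hi
    obtain ⟨j, rfl⟩ := Nat.exists_eq_add_of_le (Nat.lt_succ_iff.mp (Finset.mem_range.mp hi))
    have hqi : 0 < q ^ i := by positivity
    have h1 : ((e / q ^ i : ℕ) : ℤ) * (q : ℤ) ^ i ≤ e := by
      exact_mod_cast Nat.div_mul_le_self e (q ^ i)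
    have h2 : (e : ℤ) < ((e / q ^ i : ℕ) + 1) * (q : ℤ) ^ i := by
      exact_mod_cast Nat.mul_comm _ _ ▸ Nat.lt_mul_div_succ e hqi
    have hd' : (d : ℤ) =
        ((i + j : ℕ) * (q : ℤ) ^ 2 - 3 * q + 1) * (q : ℤ) ^ j * (q : ℤ) ^ i - e := by
      rw [hd]; ring
    refine natCast_ceil_div_pow hq0 ?_ ?_ <;> rw [hd', Nat.add_sub_cancel_left] <;> linarith
  have h1 : ((⌈(d : ℚ) / (q : ℚ) ^ (m + 1)⌉₊ : ℕ) : ℤ) = m * q - 2 := by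
    refine natCast_ceil_div_pow hq0 ?_ ?_ <;> rw [hd, pow_succ (q : ℤ) (m + 1), pow_succ] <;>
      nlinarith
  have h2 : ((⌈(d : ℚ) / (q : ℚ) ^ (m + 2)⌉₊ : ℕ) : ℤ) = m := by
    refine natCast_ceil_div_pow hq0 ?_ ?_ <;> rw [hd, pow_succ (q : ℤ) (m + 1), pow_succ] <;>
      nlinarith
  have hsum : ∑ i ∈ Finset.range (m + 1), ((e / q ^ i : ℕ) : ℤ) = e + (e / q : ℕ) := by
    obtain ⟨j, rfl⟩ := Nat.exists_eq_add_of_le' hm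
    rw [Finset.sum_range_succ', Finset.sum_range_succ', Finset.sum_eq_zero]
    · simp [add_comm]
    · intro i _
      rw [Nat.div_eq_of_lt (heq.trans_le (Nat.pow_le_pow_right hq0 (by lia)))]
      rfl
  have hrefl : ∑ i ∈ Finset.range (m + 1), (q : ℤ) ^ (m - i) =
      ∑ i ∈ Finset.range (m + 1), (q : ℤ) ^ i := by
    rw [← Finset.sum_range_reflect]
    exact Finset.sum_congr rfl fun i hi ↦ by
      rw [Nat.add_sub_cancel, Nat.sub_sub_self (Nat.lt_succ_iff.mp (Finset.mem_range.mp hi))]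
  rw [Finset.sum_congr rfl hlow, h1, h2, Finset.sum_sub_distrib, ← Finset.mul_sum, hrefl, hsum,
    geom_sum_succ (n := m + 2), geom_sum_succ (n := m + 1)]
  ring

/-! ### The subspaces of the construction -/

section Construction

open Polynomial
open scoped LinearAlgebra.Projectivization Classical

variable (F : Type*) [Field F] (m : ℕ)

/-- The space `F[X]_{≤ m} × F × F` of dimension `m + 3` in which the columns of the code live. -/
abbrev ColumnSpace : Type _ := degreeLT F (m + 1) × F × F

namespace ColumnSpace

/-- The coefficient of `X ^ m` of the polynomial part. -/
noncomputable def lead : Module.Dual F (ColumnSpace F m) :=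
  lcoeff F m ∘ₗ (degreeLT F (m + 1)).subtype ∘ₗ LinearMap.fst F _ _

/-- Evaluation of the polynomial part at `a`. -/
noncomputable def eval (a : F) : Module.Dual F (ColumnSpace F m) :=
  leval a ∘ₗ (degreeLT F (m + 1)).subtype ∘ₗ LinearMap.fst F _ _

/-- The first scalar coordinate. -/
noncomputable def fstScalar : Module.Dual F (ColumnSpace F m) :=
  LinearMap.fst F F F ∘ₗ LinearMap.snd F _ _

/-- The second scalar coordinate. -/
noncomputable def sndScalar : Module.Dual F (ColumnSpace F m) :=
  LinearMap.snd F F F ∘ₗ LinearMap.snd F _ _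

@[simp] theorem lead_apply (v : ColumnSpace F m) : lead F m v = v.1.1.coeff m := rfl

@[simp] theorem eval_apply (a : F) (v : ColumnSpace F m) : eval F m a v = v.1.1.eval a := rfl

@[simp] theorem fstScalar_apply (v : ColumnSpace F m) : fstScalar F m v = v.2.1 := rfl

@[simp] theorem sndScalar_apply (v : ColumnSpace F m) : sndScalar F m v = v.2.2 := rfl

instance : Module.Finite F (degreeLT F (m + 1)) :=
  Module.Finite.equiv (degreeLTEquiv F (m + 1)).symm

theorem finrank_eq : Module.finrank F (ColumnSpace F m) = m + 3 := by
  rw [Module.finrank_prod, Module.finrank_prod, (degreeLTEquiv F (m + 1)).finrank_eq]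
  simp

variable {F m} in
/-- The polynomial `a X ^ m + b` as an element of `F[X]_{≤ m}`. -/
noncomputable def binomial (a b : F) : degreeLT F (m + 1) :=
  ⟨C a * X ^ m + C b, by
    rw [mem_degreeLT]
    refine (degree_add_le _ _).trans_lt (max_lt ?_ ?_)
    · exact (degree_C_mul_X_pow_le m a).trans_lt (by exact_mod_cast Nat.lt_succ_self m)
    · exact degree_C_le.trans_lt (by exact_mod_cast Nat.succ_pos m)⟩

variable {F m} in
theorem coeff_binomial_self (hm : m ≠ 0) (a b : F) :
    (binomial a b : degreeLT F (m + 1)).1.coeff m = a := by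
  simp only [binomial, coeff_add, coeff_C_mul, coeff_X_pow_self, mul_one, coeff_C, hm, if_false,
    add_zero]

variable {F m} in
theorem eval_binomial (a b x : F) :
    (binomial a b : degreeLT F (m + 1)).1.eval x = a * x ^ m + b := by
  simp [binomial]

/-- The hyperplane of vectors whose polynomial part has degree less than `m`. -/
noncomputable def leadHyperplane : Submodule F (ColumnSpace F m) := LinearMap.ker (lead F m)

/-- The hyperplane on which the second scalar vanishes. -/
noncomputable def scalarHyperplane : Submodule F (ColumnSpace F m) :=
  LinearMap.ker (sndScalar F m)

/-- The space of codimension two on which both scalars vanish. -/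
noncomputable def axis : Submodule F (ColumnSpace F m) :=
  LinearMap.ker (sndScalar F m) ⊓ LinearMap.ker (fstScalar F m)

/-- The space of codimension two of all `(p, g, s)` with `g + a s = 0` and `p(a) = 0`. -/
noncomputable def evalSubspace (a : F) : Submodule F (ColumnSpace F m) :=
  LinearMap.ker (fstScalar F m + a • sndScalar F m) ⊓ LinearMap.ker (eval F m a)

variable {F m}

theorem mem_leadHyperplane {v : ColumnSpace F m} :
    v ∈ leadHyperplane F m ↔ v.1.1.coeff m = 0 := by
  simp [leadHyperplane]

theorem mem_scalarHyperplane {v : ColumnSpace F m} : v ∈ scalarHyperplane F m ↔ v.2.2 = 0 := by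
  simp [scalarHyperplane]

theorem mem_axis {v : ColumnSpace F m} : v ∈ axis F m ↔ v.2.2 = 0 ∧ v.2.1 = 0 := by
  simp [axis]

theorem mem_evalSubspace {a : F} {v : ColumnSpace F m} :
    v ∈ evalSubspace F m a ↔ v.2.1 + a * v.2.2 = 0 ∧ v.1.1.eval a = 0 := by
  simp [evalSubspace]

theorem finrank_ker_of_apply_ne_zero {h : Module.Dual F (ColumnSpace F m)} {v : ColumnSpace F m}
    (hv : h v ≠ 0) : Module.finrank F (LinearMap.ker h) = m + 2 := by
  have h1 := Module.Dual.finrank_ker_add_one_of_ne_zero (f := h)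
    fun h0 ↦ hv (by rw [h0, LinearMap.zero_apply])
  rw [finrank_eq] at h1
  lia

theorem finrank_leadHyperplane : Module.finrank F (leadHyperplane F m) = m + 2 :=
  finrank_ker_of_apply_ne_zero (m := m) (v := (binomial 1 (if m = 0 then 0 else 1), 0, 0)) (by
    by_cases hm : m = 0 <;> simp [binomial, hm, coeff_one])

theorem finrank_scalarHyperplane : Module.finrank F (scalarHyperplane F m) = m + 2 :=
  finrank_ker_of_apply_ne_zero (v := (0, 0, 1)) (by simp)

theorem finrank_axis : Module.finrank F (axis F m) = m + 1 := by
  have h1 := finrank_inf_ker_add_one (LinearMap.ker (sndScalar F m)) (fstScalar F m)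
    (u := (0, 1, 0)) (by simp) (by simp)
  rw [finrank_ker_of_apply_ne_zero (v := (0, 0, 1)) (by simp)] at h1
  exact Nat.succ_injective h1

theorem finrank_evalSubspace (a : F) : Module.finrank F (evalSubspace F m a) = m + 1 := by
  have h1 := finrank_inf_ker_add_one (LinearMap.ker (fstScalar F m + a • sndScalar F m))
    (eval F m a) (u := (binomial 0 1, 0, 0)) (by simp) (by simp [binomial])
  rw [finrank_ker_of_apply_ne_zero (v := (0, 1, 0)) (by simp)] at h1
  exact Nat.succ_injective h1

variable (m) in
/-- For `c ≠ 0` the line of all vectors `(c (u X ^ m + w), u, w)`. Its points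
have defect at most one, and different `c` give disjoint lines. -/
noncomputable def line (c : Fˣ) : Submodule F (ColumnSpace F m) where
  carrier := {v | v.1 = binomial (c * v.2.1) (c * v.2.2)}
  zero_mem' := by
    ext1; simp [binomial]
  add_mem' := by
    intro v w hv hw
    simp only [Set.mem_ofPred_eq] at hv hw ⊢
    ext1
    simp only [Prod.fst_add, Prod.snd_add, hv, hw, binomial, Submodule.coe_add, mul_add, C_add]
    ring
  smul_mem' := by
    intro t v hv
    simp only [Set.mem_ofPred_eq] at hv ⊢
    ext1
    simp only [Prod.smul_fst, Prod.smul_snd, hv, binomial, Submodule.coe_smul, smul_eq_C_mul,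
      smul_eq_mul, C_mul]
    ring

theorem mem_line {c : Fˣ} {v : ColumnSpace F m} :
    v ∈ line m c ↔ v.1 = binomial (c * v.2.1) (c * v.2.2) := Iff.rfl

theorem finrank_line (c : Fˣ) : Module.finrank F (line m c) = 2 := by
  let e : line m c ≃ₗ[F] F × F :=
    { toFun := fun v ↦ v.1.2
      invFun := fun z ↦ ⟨(binomial (c * z.1) (c * z.2), z), rfl⟩
      map_add' := fun _ _ ↦ rfl
      map_smul' := fun _ _ ↦ rfl
      left_inv := fun v ↦ Subtype.ext (Prod.ext (mem_line.mp v.2).symm rfl)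
      right_inv := fun _ ↦ rfl }
  rw [e.finrank_eq]
  simp

theorem disjoint_line (hm : m ≠ 0) : Pairwise fun c c' : Fˣ ↦ Disjoint (line m c) (line m c') := by
  intro c c' hc
  rw [Submodule.disjoint_def]
  rintro ⟨p, u, w⟩ hv hv'
  rw [mem_line] at hv hv'
  simp only at hv hv'
  have hcc : (c : F) - c' ≠ 0 := sub_ne_zero.mpr fun h ↦ hc (Units.ext h)
  have h := hv.symm.trans hv'
  have h0 := congrArg (fun p : degreeLT F (m + 1) ↦ p.1.eval 0) h
  have h1 := congrArg (fun p : degreeLT F (m + 1) ↦ p.1.coeff m) h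
  simp only [coeff_binomial_self hm, eval_binomial, zero_pow hm, mul_zero, zero_add] at h0 h1
  have hw : w = 0 := by
    rw [← sub_eq_zero, ← sub_mul] at h0
    exact (mul_eq_zero.mp h0).resolve_left hcc
  have hu : u = 0 := by
    rw [← sub_eq_zero, ← sub_mul] at h1
    exact (mul_eq_zero.mp h1).resolve_left hcc
  subst hw hu
  refine Prod.ext (Subtype.ext ?_) rfl
  rw [hv]
  simp [binomial]

/-- The hyperplanes containing `axis F m` form the pencil `s = 0`, `g + a s = 0` in the scalars
`g`, `s`. The first is `scalarHyperplane F m`, the others contain `evalSubspace F m a`. -/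
theorem vanishes_of_vanishes_axis {h : Module.Dual F (ColumnSpace F m)}
    (hA : ∀ v ∈ axis F m, h v = 0) :
    (∀ v ∈ scalarHyperplane F m, h v = 0) ∨ ∃ a, ∀ v ∈ evalSubspace F m a, h v = 0 := by
  have hform : ∀ v : ColumnSpace F m, h v = v.2.1 * h (0, 1, 0) + v.2.2 * h (0, 0, 1) := by
    rintro ⟨p, u, w⟩
    have h1 : ((p, u, w) : ColumnSpace F m) = (p, 0, 0) + u • (0, 1, 0) + w • (0, 0, 1) := by
      simp
    rw [h1, map_add, map_add, map_smul, map_smul, hA _ (mem_axis.mpr ⟨rfl, rfl⟩)]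
    simp
  by_cases h0 : h (0, 1, 0) = 0
  · refine Or.inl fun v hv ↦ ?_
    rw [hform, h0, mem_scalarHyperplane.mp hv]
    simp
  · refine Or.inr ⟨h (0, 0, 1) / h (0, 1, 0), fun v hv ↦ ?_⟩
    have h1 := (mem_evalSubspace.mp hv).1
    rw [hform]
    linear_combination h (0, 1, 0) * h1 - v.2.2 * div_mul_cancel₀ (h (0, 0, 1)) h0

/-! ### Multiplicities -/

variable [Fintype F]

/-- The number of copies of a point that are removed from `m` copies of the whole space: the sum
of the indicators of the two hyperplanes and of the spaces `evalSubspace F m a`, minus the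
indicator of `axis F m`. -/
noncomputable def defect (v : ColumnSpace F m) : ℤ :=
  (if v ∈ leadHyperplane F m then 1 else 0) + (if v ∈ scalarHyperplane F m then 1 else 0) +
    ∑ a, (if v ∈ evalSubspace F m a then 1 else 0) - (if v ∈ axis F m then 1 else 0)

theorem sum_evalSubspace_le_one {v : ColumnSpace F m} (hv : v.2.2 ≠ 0) :
    ∑ a, (if v ∈ evalSubspace F m a then 1 else 0 : ℤ) ≤ 1 := by
  rw [Finset.sum_boole]
  norm_cast
  rw [Finset.card_le_one]
  intro a ha b hb
  simp only [Finset.mem_filter, Finset.mem_univ, true_and, mem_evalSubspace] at ha hb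
  exact mul_right_cancel₀ hv (add_left_cancel (ha.1.trans hb.1.symm))

theorem sum_evalSubspace_eq_zero {v : ColumnSpace F m} (hv : v.2.2 = 0) (hv' : v.2.1 ≠ 0) :
    ∑ a, (if v ∈ evalSubspace F m a then 1 else 0 : ℤ) = 0 :=
  Finset.sum_eq_zero fun a _ ↦ if_neg fun h ↦ hv' (by simpa [hv] using (mem_evalSubspace.mp h).1)

/-- A nonzero polynomial of degree at most `m` has at most `m` roots on the projective line, `∞`
being a root if the coefficient of `X ^ m` vanishes. -/
theorem leadHyperplane_add_sum_evalSubspace_le {v : ColumnSpace F m} (hv : v ≠ 0)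
    (h₁ : v.2.1 = 0) (h₂ : v.2.2 = 0) :
    (if v ∈ leadHyperplane F m then 1 else 0) +
      ∑ a, (if v ∈ evalSubspace F m a then 1 else 0 : ℤ) ≤ m := by
  obtain ⟨⟨p, hp⟩, u, w⟩ := v
  simp only at h₁ h₂
  subst h₁ h₂
  have hp0 : p ≠ 0 := by
    rintro rfl
    exact hv rfl
  have hdeg : p.natDegree ≤ m := by
    rw [mem_degreeLT] at hp
    exact Nat.lt_succ_iff.mp ((natDegree_lt_iff_degree_lt hp0).mpr hp)
  have hroots : Finset.card {a | ((⟨p, hp⟩, 0, 0) : ColumnSpace F m) ∈ evalSubspace F m a} ≤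
      p.natDegree := by
    refine (Finset.card_le_card fun a ha ↦ ?_).trans
      ((Multiset.toFinset_card_le _).trans p.card_roots')
    simpa [hp0, mem_evalSubspace] using ha
  rw [Finset.sum_boole]
  split_ifs with h
  · rw [mem_leadHyperplane] at h
    have hlt : p.natDegree < m := lt_of_le_of_ne hdeg fun heq ↦
      hp0 (leadingCoeff_eq_zero.mp (by rw [leadingCoeff, heq]; exact h))
    lia
  · lia

theorem defect_le (hm : 2 ≤ m) {v : ColumnSpace F m} (hv : v ≠ 0) : defect v ≤ m := by
  have hm' : (2 : ℤ) ≤ m := by exact_mod_cast hm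
  unfold defect
  have hE : (if v ∈ leadHyperplane F m then 1 else 0 : ℤ) ≤ 1 := by split_ifs <;> norm_num
  simp only [mem_scalarHyperplane, mem_axis]
  by_cases h₂ : v.2.2 = 0
  · by_cases h₁ : v.2.1 = 0
    · have := leadHyperplane_add_sum_evalSubspace_le hv h₁ h₂
      simp only [h₁, h₂, and_self, if_true]
      linarith
    · have := sum_evalSubspace_eq_zero h₂ h₁
      simp only [h₁, h₂, and_false, if_true, if_false]
      linarith
  · have := sum_evalSubspace_le_one h₂
    simp only [h₂, false_and, if_false]
    linarith

theorem defect_le_one_of_mem_line (hm : m ≠ 0) {c : Fˣ} {v : ColumnSpace F m} (hv : v ≠ 0)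
    (hc : v ∈ line m c) : defect v ≤ 1 := by
  obtain ⟨p, u, w⟩ := v
  obtain rfl : p = binomial (c * u) (c * w) := hc
  unfold defect
  simp only [mem_scalarHyperplane, mem_axis]
  have hE : ((binomial (c * u) (c * w), u, w) : ColumnSpace F m) ∈ leadHyperplane F m ↔
      u = 0 := by
    simp [mem_leadHyperplane, coeff_binomial_self hm]
  by_cases hw : w = 0
  · subst hw
    have hu : u ≠ 0 := by
      rintro rfl
      refine hv (Prod.ext (Subtype.ext ?_) rfl)
      simp [binomial]
    have := sum_evalSubspace_eq_zero (m := m) (v := (binomial (c * u) (c * 0), u, 0)) rfl hu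
    simp only [hE, hu, and_false, if_true, if_false, this]
    norm_num
  · by_cases hu : u = 0
    · subst hu
      have : ∑ a, (if ((binomial (c * 0) (c * w), 0, w) : ColumnSpace F m) ∈
          evalSubspace F m a then 1 else 0 : ℤ) = 0 := by
        refine Finset.sum_eq_zero fun a _ ↦ if_neg fun h ↦ ?_
        obtain ⟨h1, h2⟩ := mem_evalSubspace.mp h
        have ha : a = 0 := by simpa [hw] using h1
        simp [eval_binomial, ha, hm, hw] at h2
      simp only [hE, hw, false_and, if_true, if_false, this]
      norm_num
    · have := sum_evalSubspace_le_one (m := m) (v := (binomial (c * u) (c * w), u, w)) hw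
      simp only [hE, hu, hw, false_and, if_false] at this ⊢
      linarith

theorem sum_defect (S : Finset (ℙ F (ColumnSpace F m))) :
    ∑ x ∈ S, defect x.rep =
      (Finset.card {x ∈ S | x.rep ∈ leadHyperplane F m} : ℤ) +
      Finset.card {x ∈ S | x.rep ∈ scalarHyperplane F m} +
      ∑ a, (Finset.card {x ∈ S | x.rep ∈ evalSubspace F m a} : ℤ) -
      Finset.card {x ∈ S | x.rep ∈ axis F m} := by
  simp only [defect, Finset.sum_sub_distrib, Finset.sum_add_distrib]
  rw [Finset.sum_comm (s := S)]
  simp only [Finset.sum_boole]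

section Sums

variable [Fintype (ℙ F (ColumnSpace F m))]

/-- The number of points counted with multiplicity `m - defect`. -/
theorem sum_sub_defect :
    ∑ x : ℙ F (ColumnSpace F m), (m - defect x.rep) =
      m * ∑ i ∈ Finset.range (m + 3), (Fintype.card F : ℤ) ^ i
        - 2 * ∑ i ∈ Finset.range (m + 2), (Fintype.card F : ℤ) ^ i
        - (Fintype.card F - 1) * ∑ i ∈ Finset.range (m + 1), (Fintype.card F : ℤ) ^ i := by
  have htop := card_projPoints (⊤ : Submodule F (ColumnSpace F m)) (r := m + 3)
    (by rw [finrank_top, finrank_eq])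
  have hE := card_projPoints _ (finrank_leadHyperplane (F := F) (m := m))
  have hG := card_projPoints _ (finrank_scalarHyperplane (F := F) (m := m))
  have hA := card_projPoints _ (finrank_axis (F := F) (m := m))
  have hL := fun a ↦ card_projPoints _ (finrank_evalSubspace (F := F) (m := m) a)
  simp only [projPoints, Submodule.mem_top, Finset.filter_true] at htop hE hG hA hL
  rw [Finset.sum_sub_distrib, sum_defect, Finset.sum_const, htop, hE, hG, hA]
  simp only [hL, Finset.sum_const, Finset.card_univ, nsmul_eq_mul]
  push_cast
  ring

/-- In the absence of `axis F m` the sum of the weights of the removed spaces would be at most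
`2 q ^ (m + 1) + q * q ^ m`. The subtracted axis lowers it by another `q ^ m`, except when `h`
vanishes on the axis; then one of the other removed spaces contributes nothing instead. -/
theorem le_sum_sub_defect_of_ne_zero {h : Module.Dual F (ColumnSpace F m)} (hh : h ≠ 0) :
    m * (Fintype.card F : ℤ) ^ (m + 2) - 3 * (Fintype.card F : ℤ) ^ (m + 1)
        + (Fintype.card F : ℤ) ^ m ≤
      ∑ x : ℙ F (ColumnSpace F m) with h x.rep ≠ 0, (m - defect x.rep) := by
  obtain ⟨v₀, hv₀⟩ : ∃ v, h v ≠ 0 := by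
    by_contra! h0
    exact hh (LinearMap.ext h0)
  set q := Fintype.card F with hq
  have htop := card_projPoints_filter_ne (⊤ : Submodule F (ColumnSpace F m)) h (r := m + 2)
    (by rw [finrank_top, finrank_eq]) Submodule.mem_top hv₀
  have hE := card_projPoints_filter_ne_le _ h (finrank_leadHyperplane (F := F) (m := m))
  have hG := card_projPoints_filter_ne_le _ h (finrank_scalarHyperplane (F := F) (m := m))
  have hL := fun a ↦ card_projPoints_filter_ne_le _ h (finrank_evalSubspace (F := F) (m := m) a)
  have hcomm : ∀ U : Submodule F (ColumnSpace F m),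
      ({x ∈ ({x | h x.rep ≠ 0} : Finset (ℙ F (ColumnSpace F m))) | x.rep ∈ U}) =
        {x ∈ projPoints U | h x.rep ≠ 0} := by
    intro U
    rw [projPoints, Finset.filter_comm]
  rw [Finset.sum_sub_distrib, sum_defect, Finset.sum_const]
  simp only [hcomm]
  simp only [projPoints, Submodule.mem_top, Finset.filter_true] at htop
  rw [htop]
  have hE' : (Finset.card {x ∈ projPoints (leadHyperplane F m) | h x.rep ≠ 0} : ℤ) ≤
      (q : ℤ) ^ (m + 1) := by exact_mod_cast hE
  have hG' : (Finset.card {x ∈ projPoints (scalarHyperplane F m) | h x.rep ≠ 0} : ℤ) ≤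
      (q : ℤ) ^ (m + 1) := by exact_mod_cast hG
  have hL' : ∀ a, (Finset.card {x ∈ projPoints (evalSubspace F m a) | h x.rep ≠ 0} : ℤ) ≤
      (q : ℤ) ^ m := fun a ↦ by exact_mod_cast hL a
  have hLsum : ∑ a, (Finset.card {x ∈ projPoints (evalSubspace F m a) | h x.rep ≠ 0} : ℤ) ≤
      q * (q : ℤ) ^ m := by
    refine (Finset.sum_le_sum fun a _ ↦ hL' a).trans (le_of_eq ?_)
    simp [hq]
  have hpow : (q : ℤ) ^ (m + 1) = q * (q : ℤ) ^ m := pow_succ' _ _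
  have hqm : (0 : ℤ) ≤ (q : ℤ) ^ m := by positivity
  simp only [nsmul_eq_mul]
  push_cast
  by_cases hA : ∀ v ∈ axis F m, h v = 0
  · rw [card_projPoints_filter_ne_eq_zero _ h hA]
    rcases vanishes_of_vanishes_axis hA with hS | ⟨a, ha⟩
    · rw [card_projPoints_filter_ne_eq_zero _ h hS]
      have hqq : (q : ℤ) ^ m ≤ (q : ℤ) ^ (m + 1) := by
        exact_mod_cast Nat.pow_le_pow_right Fintype.card_pos (Nat.le_succ m)
      push_cast
      linarith
    · have hLsum' : ∑ a, (Finset.card {x ∈ projPoints (evalSubspace F m a) | h x.rep ≠ 0} : ℤ) ≤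
          (q - 1) * (q : ℤ) ^ m := by
        rw [← Finset.add_sum_erase _ _ (Finset.mem_univ a),
          card_projPoints_filter_ne_eq_zero _ h ha, Nat.cast_zero, zero_add]
        refine (Finset.sum_le_sum fun a _ ↦ hL' a).trans (le_of_eq ?_)
        have hq1 : 1 ≤ q := Fintype.card_pos
        rw [Finset.sum_const, Finset.card_erase_of_mem (Finset.mem_univ a), Finset.card_univ,
          nsmul_eq_mul, ← hq]
        push_cast [hq1]
        ring
      push_cast
      linarith
  · push Not at hA
    obtain ⟨v, hv, hhv⟩ := hA
    rw [card_projPoints_filter_ne _ h finrank_axis hv hhv]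
    push_cast
    linarith

end Sums

variable (F) in
/-- The columns are the points `x` with multiplicity `m - defect x`, each lowered by one on the
points selected by `exists_points_on_lines`; on the lines the multiplicity is at least
`m - 1 ≥ 1`, so this stays nonnegative. -/
theorem exists_isLinearCode_griesmerBound (hm : 2 ≤ m) (hq : 3 ≤ Fintype.card F) {d e : ℕ}
    (he : e + Fintype.card F ≤ Fintype.card F ^ 2) (hd0 : 0 < d)
    (hd : (d : ℤ) = m * (Fintype.card F : ℤ) ^ (m + 2) - 3 * (Fintype.card F : ℤ) ^ (m + 1)
      + (Fintype.card F : ℤ) ^ m - e) :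
    ∃ C : Submodule F (Fin (griesmerBound (Fintype.card F) (m + 3) d) → F),
      IsLinearCode (griesmerBound (Fintype.card F) (m + 3) d) (m + 3) d C := by
  have : Finite (ColumnSpace F m) := Module.finite_of_finite F
  have : Fintype (ℙ F (ColumnSpace F m)) := Fintype.ofFinite _
  have hf : ∀ c : Fˣ, Module.finrank F (line m c) = 2 := finrank_line
  have hdj := disjoint_line (F := F) (show m ≠ 0 by lia)
  obtain ⟨R, hRcard, hRline, hRh⟩ :=
    exists_points_on_lines (V := ColumnSpace F m) (line m) hf hdj (e := e) he
  have hcast : ∀ x : ℙ F (ColumnSpace F m),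
      (((m - defect x.rep - if x ∈ R then 1 else 0).toNat : ℕ) : ℤ) =
        m - defect x.rep - if x ∈ R then 1 else 0 := by
    intro x
    refine Int.toNat_of_nonneg ?_
    split_ifs with hx
    · obtain ⟨c, hc⟩ := hRline x hx
      have := defect_le_one_of_mem_line (by lia) x.rep_nonzero hc
      lia
    · have := defect_le hm x.rep_nonzero
      lia
  refine exists_isLinearCode_of_multiplicity (finrank_eq F m) hd0
    (fun x ↦ (m - defect x.rep - if x ∈ R then 1 else 0).toNat) ?_ fun h hh ↦ ?_
  · zify
    rw [Finset.sum_congr rfl fun x _ ↦ hcast x, Finset.sum_sub_distrib,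
      sum_sub_defect, Finset.sum_boole, griesmerBound_eq hq hm he hd,
      Finset.filter_univ_mem, hRcard]
    push_cast
    ring
  · zify
    rw [Finset.sum_congr rfl fun x _ ↦ hcast x, Finset.sum_sub_distrib, Finset.sum_boole]
    have h1 := le_sum_sub_defect_of_ne_zero hh
    have h2 := hRh h
    have h3 : ({x ∈ ({x | h x.rep ≠ 0} : Finset (ℙ F (ColumnSpace F m))) | x ∈ R}) =
        {x ∈ R | h x.rep ≠ 0} := by
      ext x; simp [and_comm]
    rw [h3, hd]
    zify at h2
    linarith

end ColumnSpace

end Construction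

theorem theorem1 {F : Type*} [Field F] [Fintype F] [DecidableEq F] (q k d : ℕ)
    (hF : Fintype.card F = q) (hk : 5 ≤ k) (hq : k - 2 ≤ q)
    (hd₁ : ((k : ℤ) - 3) * (q : ℤ) ^ (k - 1) - 3 * (q : ℤ) ^ (k - 2) + (q : ℤ) ^ (k - 3)
      - (q : ℤ) ^ 2 + (q : ℤ) ≤ (d : ℤ))
    (hd₂ : (d : ℤ) ≤
      ((k : ℤ) - 3) * (q : ℤ) ^ (k - 1) - 3 * (q : ℤ) ^ (k - 2) + (q : ℤ) ^ (k - 3)) :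
    ∃ C : Submodule F (Fin (griesmerBound q k d) → F),
      IsLinearCode (griesmerBound q k d) k d C := by
  obtain ⟨m, rfl⟩ : ∃ m, k = m + 3 := ⟨k - 3, by lia⟩
  have hm : 2 ≤ m := by lia
  have hq3 : 3 ≤ q := by lia
  simp only [show m + 3 - 1 = m + 2 by lia, show m + 3 - 2 = m + 1 by lia, Nat.add_sub_cancel,
    Nat.cast_add, Nat.cast_ofNat, add_sub_cancel_right] at hd₁ hd₂
  obtain ⟨e, he⟩ := Int.eq_ofNat_of_zero_le (sub_nonneg.mpr hd₂)
  have heq : e + q ≤ q ^ 2 := by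
    zify
    linarith
  have hd : (d : ℤ) = m * (q : ℤ) ^ (m + 2) - 3 * (q : ℤ) ^ (m + 1) + (q : ℤ) ^ m - e := by
    linarith
  have hd0 : 0 < d := by
    have h1 : (3 : ℤ) * q ^ (m + 1) ≤ m * q ^ (m + 2) := by
      have : (3 : ℤ) ≤ q := by exact_mod_cast hq3
      have : (1 : ℤ) ≤ m := by exact_mod_cast (by lia : 1 ≤ m)
      rw [pow_succ' (q : ℤ) (m + 1), ← mul_assoc]
      gcongr
      nlinarith
    have h2 : e < q ^ m := by
      have := Nat.pow_le_pow_right (show 0 < q by lia) hm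
      lia
    zify at h2 ⊢
    linarith
  subst hF
  convert ColumnSpace.exists_isLinearCode_griesmerBound F hm hq3 heq hd0 hd
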